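/- Let $X_i(z), Y_i(z)$ ($1\le i\le N$) be symplectic bosons acting on a complex vector space $V$: fields on $V$ whose OPEs are $X_i(z)Y_j(w)\sim \delta_{ij}/(z-w)$, $X_i(z)X_j(w)\sim 0$, $Y_i(z)Y_j(w)\sim 0$. For (bosonic) fields $A,B$ and $p\in\mathbb{Z}$ put $$(AB)_p(w)=\oint\frac{dz}{2\pi i}(z-w)^{p-1}A(z)B(w)$$ (radially ordered, $z$ encircling $w$), so that $(AB)_0$ is the normally ordered product. Put $\mathcal A_i=-(X_iY_i)_0$, $\mathcal D_i\mathcal O=(\mathcal A_i\mathcal O)_0+(X_i(Y_i\mathcal O)_0)_0$ and $D_i\mathcal O=\mathcal D_i\mathcal O+(\mathcal A_i\mathcal O)_0$. For each $i$ let each of $P_i$ and $Q_i$ be one of $X_i$, $D_iX_i$, and set $$\mathcal P_1=P_1,\quad \mathcal P_{n+1}=(P_{n+1}\mathcal P_n)_0,\qquad \mathcal Q_1=Q_1,\quad \mathcal Q_{n+1}=(Q_{n+1}\mathcal Q_n)_0 .$$ Let $R_{P_i,Q_i}=-(X_iX_i)_0$ if $P_i=X_i$ and $Q_i=D_iX_i$;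 $R_{P_i,Q_i}=(X_iX_i)_0$ if $P_i=D_iX_i$ and $Q_i=X_i$; and $R_{P_i,Q_i}=0$ if $P_i=Q_i$. Then for every integer $n$ with $1\le n$ and $n+1\le N$ and every integer $p$, $$(\mathcal P_{n+1}\mathcal Q_{n+1})_p=\begin{cases}\bigl(R_{P_{n+1},Q_{n+1}}(\mathcal P_n\mathcal Q_n)_{p-1}\bigr)_0+\displaystyle\sum_{q=p}^{n}\bigl(P_{n+1}(Q_{n+1}(\mathcal P_n\mathcal Q_n)_q)_0\bigr)_{p-q} & (p\le n)\\[2mm] \bigl(R_{P_{n+1},Q_{n+1}}(\mathcal P_n\mathcal Q_n)_{p-1}\bigr)_0 & (p=n+1)\\[1mm] 0 & (p\ge n+2).\end{cases}$$ In particular, if $P_{n+1}=Q_{n+1}$, then $(\mathcal P_{n+1}\mathcal Q_{n+1})_p=\sum_{q=p}^{n}\bigl(P_{n+1}(Q_{n+1}(\mathcal P_n\mathcal Q_n)_q)_0\bigr)_{p-q}$ for $p\le n$, and $(\mathcal P_{n+1}\mathcal Q_{n+1})_p=0$ for $p\ge n+1$. -/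

import Mathlib

noncomputable section

namespace SymplecticBoson

open VertexOperator

section Fields

variable {V : Type*} [AddCommGroup V] [Module ℂ V]

/-- Every vector is annihilated by all modes of a field of sufficiently high index. -/
theorem exists_ncoeff_eq_zero (A : VertexOperator ℂ V) (v : V) :
    ∃ M : ℤ, ∀ m : ℤ, M ≤ m → ncoeff A m v = 0 := by
  refine ⟨-(HahnSeries.order ((HahnModule.of ℂ).symm (A v))), fun m hm => ?_⟩
  exact ncoeff_eq_zero_of_lt_order A m v (by omega)

/-- The `j`-th term of the `m`-th mode of the residue product `A_(k) B`, namely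
`(-1)^j * binom k j * (A_(k-j) B_(m+j) - (-1)^k * B_(m+k-j) A_(j))`. -/
def resTerm (k : ℤ) (A B : VertexOperator ℂ V) (m : ℤ) (j : ℕ) : Module.End ℂ V :=
  ((-1 : ℤ) ^ j * Ring.choose k j) •
    (ncoeff A (k - j) * ncoeff B (m + j) -
      (Int.negOnePow k : ℤ) • (ncoeff B (m + k - j) * ncoeff A (j : ℤ)))

theorem resTerm_eventually_zero (k : ℤ) (A B : VertexOperator ℂ V) (m : ℤ) (v : V) :
    ∃ J : ℕ, ∀ j : ℕ, J ≤ j → resTerm k A B m j v = 0 := by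
  obtain ⟨M, hM⟩ := exists_ncoeff_eq_zero A v
  obtain ⟨M', hM'⟩ := exists_ncoeff_eq_zero B v
  refine ⟨M.toNat + (M' - m).toNat, fun j hj => ?_⟩
  have h1 : ncoeff A (j : ℤ) v = 0 := hM _ (by omega)
  have h2 : ncoeff B (m + j) v = 0 := hM' _ (by omega)
  simp [resTerm, h1, h2]

theorem resTerm_support_finite (k : ℤ) (A B : VertexOperator ℂ V) (m : ℤ) (v : V) :
    (Function.support fun j : ℕ => resTerm k A B m j v).Finite := by
  obtain ⟨J, hJ⟩ := resTerm_eventually_zero k A B m v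
  refine (Set.finite_lt_nat J).subset fun j hj => ?_
  by_contra h
  exact hj (hJ j (not_lt.mp h))

/-- The `m`-th mode of the residue product `A_(k) B`. On every vector the sum has only finitely
many nonzero terms. -/
def resMode (k : ℤ) (A B : VertexOperator ℂ V) (m : ℤ) : Module.End ℂ V where
  toFun v := ∑ᶠ j : ℕ, resTerm k A B m j v
  map_add' u v := by
    simp only [map_add]
    exact finsum_add_distrib (resTerm_support_finite k A B m u)
      (resTerm_support_finite k A B m v)
  map_smul' c v := by
    simp only [map_smul, RingHom.id_apply]
    exact (smul_finsum c _).symm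

theorem resMode_truncated (k : ℤ) (A B : VertexOperator ℂ V) (v : V) :
    ∃ M : ℤ, ∀ m : ℤ, M ≤ m → resMode k A B m v = 0 := by
  obtain ⟨MA, hMA⟩ := exists_ncoeff_eq_zero A v
  obtain ⟨MB, hMB⟩ := exists_ncoeff_eq_zero B v
  choose L hL using fun j : ℕ => exists_ncoeff_eq_zero B (ncoeff A (j : ℤ) v)
  obtain ⟨K, hK⟩ : ∃ K : ℤ, ∀ j ∈ Finset.range MA.toNat, L j - k + j ≤ K := by
    obtain ⟨K, hK⟩ := ((Finset.range MA.toNat).image fun j : ℕ => L j - k + j).bddAbove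
    exact ⟨K, fun j hj => hK (Finset.mem_coe.mpr (Finset.mem_image_of_mem _ hj))⟩
  refine ⟨max MB K, fun m hm => ?_⟩
  have hB : MB ≤ m := (le_max_left _ _).trans hm
  have hm' : K ≤ m := (le_max_right _ _).trans hm
  have key : ∀ j : ℕ, resTerm k A B m j v = 0 := by
    intro j
    have h1 : ncoeff B (m + j) v = 0 := hMB _ (by omega)
    have h2 : ncoeff B (m + k - j) (ncoeff A (j : ℤ) v) = 0 := by
      by_cases hj : j < MA.toNat
      · have := hK j (Finset.mem_range.mpr hj)
        exact hL j _ (by omega)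
      · rw [hMA j (by omega), map_zero]
    simp [resTerm, h1, h2]
  change ∑ᶠ j : ℕ, resTerm k A B m j v = 0
  simp [key]

/-- A field with prescribed modes `f m`, i.e. `∑ m, f m * z ^ (-m-1)`. -/
def ofModes (f : ℤ → Module.End ℂ V) (hf : ∀ v, ∃ M : ℤ, ∀ m : ℤ, M ≤ m → f m v = 0) :
    VertexOperator ℂ V :=
  VertexOperator.of_coeff (fun n => f (-n - 1)) fun v => by
    obtain ⟨M, hM⟩ := hf v
    refine ⟨-M, fun n hn => ?_⟩
    by_contra h
    exact hn (hM _ (by omega))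

@[simp]
theorem ncoeff_ofModes (f : ℤ → Module.End ℂ V)
    (hf : ∀ v, ∃ M : ℤ, ∀ m : ℤ, M ≤ m → f m v = 0) (m : ℤ) :
    ncoeff (ofModes f hf) m = f m := by
  simp [ofModes]

/-- The product of fields
`(A B)_p (w) = ∮ dz/(2πi) (z - w)^(p-1) A(z) B(w)`, the integral over a small circle around `w`
being, as usual for radially ordered products, the difference of the integrals over `|z| > |w|`
and `|z| < |w|`:
`Res_z (A(z) B(w) (z-w)^(p-1)|_{|z|>|w|} - B(w) A(z) (z-w)^(p-1)|_{|z|<|w|})`. -/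
def prod (p : ℤ) (A B : VertexOperator ℂ V) : VertexOperator ℂ V :=
  ofModes (resMode (p - 1) A B) (resMode_truncated (p - 1) A B)

/-- The identity field. -/
def idField : VertexOperator ℂ V :=
  ofModes (fun m => if m = -1 then 1 else 0) fun v =>
    ⟨0, fun m hm => by simp [show m ≠ -1 by omega]⟩

/-- The operator product expansion `A(z) B(w) ∼ C(w) / (z - w)`, in terms of modes:
`[A_(m), B_(n)] = C_(m+n)`. For `C = 0` this says that the OPE is regular. -/
def SimplePoleOPE (A B C : VertexOperator ℂ V) : Prop :=
  ∀ m n : ℤ, ncoeff A m * ncoeff B n - ncoeff B n * ncoeff A m = ncoeff C (m + n)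

end Fields

/-- A system of symplectic bosons `(X i, Y i)` acting on `V`: fields whose only nontrivial OPEs are
`X i (z) Y j (w) ∼ δ_ij / (z - w)`. -/
structure SymplecticBosons (ι : Type*) [DecidableEq ι] (V : Type*) [AddCommGroup V]
    [Module ℂ V] where
  X : ι → VertexOperator ℂ V
  Y : ι → VertexOperator ℂ V
  ope_XY : ∀ i j, SimplePoleOPE (X i) (Y j) (if i = j then idField else 0)
  ope_XX : ∀ i j, SimplePoleOPE (X i) (X j) 0
  ope_YY : ∀ i j, SimplePoleOPE (Y i) (Y j) 0

/-- The two choices `X i` and `D i (X i)` for the factors. -/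
inductive Kind
  | plain
  | cov
  deriving DecidableEq

namespace SymplecticBosons

variable {ι : Type*} [DecidableEq ι] {V : Type*} [AddCommGroup V] [Module ℂ V]
  (S : SymplecticBosons ι V)

/-- `𝒜_i = -(X_i Y_i)_0`. -/
def gauge (i : ι) : VertexOperator ℂ V := -prod 0 (S.X i) (S.Y i)

/-- `𝒜̂_i O = (𝒜_i O)_0`. -/
def gaugeHat (i : ι) (O : VertexOperator ℂ V) : VertexOperator ℂ V := prod 0 (S.gauge i) O

/-- `𝒟_i O = (𝒜_i O)_0 + (X_i (Y_i O)_0)_0`. -/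
def partialD (i : ι) (O : VertexOperator ℂ V) : VertexOperator ℂ V :=
  prod 0 (S.gauge i) O + prod 0 (S.X i) (prod 0 (S.Y i) O)

/-- `D_{i,(e)} O = 𝒟_i O + e 𝒜̂_i O`. -/
def covDWith (e : ℂ) (i : ι) (O : VertexOperator ℂ V) : VertexOperator ℂ V :=
  S.partialD i O + e • S.gaugeHat i O

/-- `D_i = D_{i,(1)}`. -/
def covD (i : ι) (O : VertexOperator ℂ V) : VertexOperator ℂ V := S.covDWith 1 i O

/-- The factor of index `i` of the given kind: `X_i` or `D_i X_i`. -/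
def factor (i : ι) : Kind → VertexOperator ℂ V
  | .plain => S.X i
  | .cov => S.covD i (S.X i)

/-- The coefficient `R_{P_i,Q_i}`. -/
def R (i : ι) : Kind → Kind → VertexOperator ℂ V
  | .plain, .cov => -prod 0 (S.X i) (S.X i)
  | .cov, .plain => prod 0 (S.X i) (S.X i)
  | .plain, .plain => 0
  | .cov, .cov => 0

end SymplecticBosons

/-- The nested product `𝒫_n` of `P_1, …, P_N` for `1 ≤ n ≤ N`:
`𝒫_1 = P_1` and `𝒫_{n+1} = (P_{n+1} 𝒫_n)_0`. The factor `P_i` is `P ⟨i - 1, _⟩`.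
(The value at `n = 0` is a convention.) -/
def nested {V : Type*} [AddCommGroup V] [Module ℂ V] {N : ℕ} (P : Fin N → VertexOperator ℂ V) :
    (n : ℕ) → n ≤ N → VertexOperator ℂ V
  | 0, _ => idField
  | 1, h => P ⟨0, h⟩
  | n + 2, h => prod 0 (P ⟨n + 1, h⟩) (nested P (n + 1) (Nat.le_of_succ_le h))

section Fock

variable (ι : Type*)

/-- The Fock space of the symplectic bosons: polynomials in the creation modes
`x_{i,k} = X_{i,(-k-1)}` (first component `true`) and `y_{i,k} = Y_{i,(-k-1)}` (`false`). -/
abbrev Fock : Type _ := MvPolynomial (Bool × ι × ℕ) ℂ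

variable {ι}

/-- Creation modes act by multiplication, annihilation modes as `s` times the derivative with
respect to the conjugate variable. -/
def fockMode (b : Bool) (s : ℂ) (i : ι) (m : ℤ) : Module.End ℂ (Fock ι) :=
  if 0 ≤ m then s • (MvPolynomial.pderiv (!b, i, m.toNat)).toLinearMap
  else LinearMap.mulLeft ℂ (MvPolynomial.X (b, i, (-m - 1).toNat))

theorem fockMode_truncated (b : Bool) (s : ℂ) (i : ι) (v : Fock ι) :
    ∃ M : ℤ, ∀ m : ℤ, M ≤ m → fockMode b s i m v = 0 := by
  classical
  obtain ⟨K, hK⟩ := (v.vars.image fun t => t.2.2).bddAbove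
  refine ⟨K + 1, fun m hm => ?_⟩
  have h0 : 0 ≤ m := by omega
  have : (!b, i, m.toNat) ∉ v.vars := fun h => by
    have := hK (Finset.mem_coe.mpr (Finset.mem_image_of_mem (fun t => t.2.2) h))
    simp only at this
    omega
  simp [fockMode, h0, MvPolynomial.pderiv_eq_zero_of_notMem_vars this]

theorem pderiv_mulLeft_comm (s t : Bool × ι × ℕ) [Decidable (t = s)] (v : Fock ι) :
    MvPolynomial.pderiv s (MvPolynomial.X t * v) -
      MvPolynomial.X t * MvPolynomial.pderiv s v = if t = s then v else 0 := by
  classical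
  rw [Derivation.leibniz, MvPolynomial.pderiv_X]
  by_cases h : t = s
  · subst h; simp
  · simp [h]

theorem pderiv_pderiv_comm (s t : Bool × ι × ℕ) (v : Fock ι) :
    MvPolynomial.pderiv s (MvPolynomial.pderiv t v) =
      MvPolynomial.pderiv t (MvPolynomial.pderiv s v) := by
  classical
  have h : ⁅(MvPolynomial.pderiv s : Derivation ℂ (Fock ι) (Fock ι)),
      (MvPolynomial.pderiv t : Derivation ℂ (Fock ι) (Fock ι))⁆ = 0 := by
    refine MvPolynomial.derivation_ext fun k => ?_
    simp only [Derivation.commutator_apply, MvPolynomial.pderiv_X, Derivation.zero_apply]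
    simp only [Pi.single_apply]
    split_ifs <;> simp
  have := congrArg (fun D => D v) h
  simpa [Derivation.commutator_apply, sub_eq_zero] using this

/-- The commutation relations of the modes on the Fock space. -/
theorem fockMode_comm [DecidableEq ι] (b c : Bool) (s t : ℂ) (i j : ι) (m n : ℤ) :
    fockMode b s i m * fockMode c t j n - fockMode c t j n * fockMode b s i m =
      if (!b) = c ∧ i = j ∧ m + n = -1 then (if 0 ≤ m then s else -t) • 1 else 0 := by
  refine LinearMap.ext fun v => ?_
  by_cases hm : 0 ≤ m <;> by_cases hn : 0 ≤ n
  · have h1 : m + n ≠ -1 := by omega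
    simp [fockMode, hm, hn, h1, pderiv_pderiv_comm (!b, i, m.toNat), smul_smul, mul_comm s t]
  · have h1 : ((c, j, (-n - 1).toNat) = (!b, i, m.toNat)) ↔
        ((!b) = c ∧ i = j ∧ m + n = -1) := by
      simp only [Prod.mk.injEq]
      refine ⟨fun ⟨h, h', h''⟩ => ⟨h.symm, h'.symm, by omega⟩,
        fun ⟨h, h', h''⟩ => ⟨h.symm, h'.symm, by omega⟩⟩
    have := pderiv_mulLeft_comm (!b, i, m.toNat) (c, j, (-n - 1).toNat) v
    simp only [fockMode, hm, hn, if_true, if_false, LinearMap.sub_apply, Module.End.mul_apply,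
      LinearMap.smul_apply, LinearMap.mulLeft_apply, mul_smul_comm, ← smul_sub,
      Derivation.coeFn_coe, this, h1]
    split_ifs <;> simp
  · have h1 : ((b, i, (-m - 1).toNat) = (!c, j, n.toNat)) ↔
        ((!b) = c ∧ i = j ∧ m + n = -1) := by
      simp only [Prod.mk.injEq]
      refine ⟨fun ⟨h, h', h''⟩ => ⟨by simp [h], h', by omega⟩,
        fun ⟨h, h', h''⟩ => ⟨by simp [← h], h', by omega⟩⟩
    have := pderiv_mulLeft_comm (!c, j, n.toNat) (b, i, (-m - 1).toNat) v
    rw [← neg_sub, LinearMap.neg_apply, ← neg_inj, neg_neg]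
    simp only [fockMode, hm, hn, if_true, if_false, LinearMap.sub_apply, Module.End.mul_apply,
      LinearMap.smul_apply, LinearMap.mulLeft_apply, mul_smul_comm, ← smul_sub,
      Derivation.coeFn_coe, this, h1]
    split_ifs <;> simp
  · have h1 : m + n ≠ -1 := by omega
    simp [fockMode, hm, hn, h1, mul_left_comm]

/-- The standard realization of the symplectic bosons on their Fock space. -/
def fockBosons (ι : Type*) [DecidableEq ι] : SymplecticBosons ι (Fock ι) where
  X i := ofModes (fockMode true 1 i) (fockMode_truncated true 1 i)
  Y i := ofModes (fockMode false (-1) i) (fockMode_truncated false (-1) i)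
  ope_XY i j m n := by
    rw [ncoeff_ofModes, ncoeff_ofModes, fockMode_comm]
    by_cases h : i = j <;> by_cases h' : m + n = -1 <;> simp [h, h', idField]
  ope_XX i j m n := by
    rw [ncoeff_ofModes, ncoeff_ofModes, fockMode_comm]
    simp
  ope_YY i j m n := by
    rw [ncoeff_ofModes, ncoeff_ofModes, fockMode_comm]
    simp

end Fock

end SymplecticBoson

end

/-!
The engine is a quasi-associativity formula. If `A(z) G(w) ∼ H(w) / (z - w)` and the OPE of `B` and
`G` has poles of order at most `K`, then
`((A B)_0 G)_p = (B H)_{p-1} + ∑_{q=p}^{K} (A (B G)_q)_{p-q}`.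
Normal ordering puts the creation modes of `A` to the left and its annihilation modes to the right
of `B`. Moving `A` past `G` produces commutators whose sum telescopes to `(B H)_{p-1}`, and what
remains is the Taylor expansion of `B(z) G(w)` around `z = w`.

Fields with regular OPE may be exchanged inside iterated products. For `A = P_{n+1}`, `B = 𝒫_n` and
`G = (Q_{n+1} 𝒬_n)_0`, Wick's formula gives `H = (R 𝒬_n)_0`, so the formula becomes the recursion
for `(𝒫_{n+1} 𝒬_{n+1})_p`; applied to `z ^ s 𝒫_{n+1}` it also shows inductively that the OPE of
`𝒫_n` and `𝒬_n` has poles of order at most `n`.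

It remains to see that `P_i` and `Q_i` have at most the simple pole `R_{P_i,Q_i}`. By Wick's formula
`D_i X_i` has a double pole with `Y_i`, but the double poles cancel in its OPE with itself; the
remaining simple pole vanishes by skew-symmetry.
-/

noncomputable section

namespace SymplecticBoson

open VertexOperator Filter

section Products

variable {V : Type*} [AddCommGroup V] [Module ℂ V] {A B C : VertexOperator ℂ V}

theorem field_ext (h : ∀ m v, ncoeff A m v = ncoeff B m v) : A = B :=
  HVertexOperator.coeff_inj <| funext fun n => LinearMap.ext fun v => by
    have := h (-n - 1) v
    rwa [ncoeff_apply, ncoeff_apply, neg_sub, sub_neg_eq_add, add_sub_cancel_left] at this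

/-- The field `z ^ s * A(z)`. -/
def shift (s : ℤ) : VertexOperator ℂ V →ₗ[ℂ] VertexOperator ℂ V where
  toFun A := ofModes (fun m => ncoeff A (s + m)) fun v => by
    obtain ⟨M, hM⟩ := exists_ncoeff_eq_zero A v
    exact ⟨M - s, fun m hm => hM _ (by omega)⟩
  map_add' A B := field_ext fun m v => by simp
  map_smul' c A := field_ext fun m v => by simp

@[simp]
theorem ncoeff_shift (s : ℤ) (A : VertexOperator ℂ V) (m : ℤ) :
    ncoeff (shift s A) m = ncoeff A (s + m) :=
  ncoeff_ofModes _ _ m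

@[simp]
theorem shift_zero (A : VertexOperator ℂ V) : shift 0 A = A :=
  field_ext fun m v => by simp

theorem shift_shift (s t : ℤ) (A : VertexOperator ℂ V) : shift s (shift t A) = shift (s + t) A :=
  field_ext fun m v => by simp only [ncoeff_shift, add_assoc, add_left_comm]

theorem shift_injective (s : ℤ) :
    Function.Injective (shift s : VertexOperator ℂ V → VertexOperator ℂ V) :=
  Function.LeftInverse.injective (g := shift (-s)) fun A => by simp [shift_shift]

/-- The field with modes `T * A_(m)`. -/
def leftMul (T : Module.End ℂ V) : VertexOperator ℂ V →ₗ[ℂ] VertexOperator ℂ V where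
  toFun A := ofModes (fun m => T * ncoeff A m) fun v => by
    obtain ⟨M, hM⟩ := exists_ncoeff_eq_zero A v
    exact ⟨M, fun m hm => by simp [hM m hm]⟩
  map_add' A B := field_ext fun m v => by simp
  map_smul' c A := field_ext fun m v => by simp

@[simp]
theorem ncoeff_leftMul (T : Module.End ℂ V) (A : VertexOperator ℂ V) (m : ℤ) :
    ncoeff (leftMul T A) m = T * ncoeff A m :=
  ncoeff_ofModes _ _ m

/-- The field with modes `A_(m) * T`. -/
def rightMul (T : Module.End ℂ V) : VertexOperator ℂ V →ₗ[ℂ] VertexOperator ℂ V where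
  toFun A := ofModes (fun m => ncoeff A m * T) fun v => by
    obtain ⟨M, hM⟩ := exists_ncoeff_eq_zero A (T v)
    exact ⟨M, fun m hm => hM m hm⟩
  map_add' A B := field_ext fun m v => by simp
  map_smul' c A := field_ext fun m v => by simp

@[simp]
theorem ncoeff_rightMul (T : Module.End ℂ V) (A : VertexOperator ℂ V) (m : ℤ) :
    ncoeff (rightMul T A) m = ncoeff A m * T :=
  ncoeff_ofModes _ _ m

/-- The derivation `A(z) ↦ [T, A(z)]` of fields given by an endomorphism `T`. -/
def ad (T : Module.End ℂ V) : VertexOperator ℂ V →ₗ[ℂ] VertexOperator ℂ V :=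
  leftMul T - rightMul T

@[simp]
theorem ncoeff_ad (T : Module.End ℂ V) (A : VertexOperator ℂ V) (m : ℤ) :
    ncoeff (ad T A) m = T * ncoeff A m - ncoeff A m * T := by
  simp [ad]

/-- The `j`-th term of the series of fields whose sum is `(A B)_p`. -/
def prodTerm (p : ℤ) (A B : VertexOperator ℂ V) (j : ℕ) : VertexOperator ℂ V :=
  ((-1 : ℤ) ^ j * Ring.choose (p - 1) j) •
    (leftMul (ncoeff A (p - 1 - j)) (shift j B) -
      (Int.negOnePow (p - 1) : ℤ) • rightMul (ncoeff A j) (shift (p - 1 - j) B))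

theorem ncoeff_prodTerm (p : ℤ) (A B : VertexOperator ℂ V) (j : ℕ) (m : ℤ) :
    ncoeff (prodTerm p A B j) m = resTerm (p - 1) A B m j := by
  simp only [prodTerm, resTerm, map_zsmul, map_sub, Pi.smul_apply, Pi.sub_apply, ncoeff_leftMul,
    ncoeff_rightMul, ncoeff_shift, add_comm, add_sub_assoc]

theorem choose_neg_one_sub_natCast (i j : ℕ) :
    Ring.choose (-1 - i : ℤ) j = (-1) ^ j * (i + j).choose j := by
  rw [← neg_add', Ring.choose_neg, show (1 + i + j - 1 : ℤ) = (i + j : ℕ) by push_cast; ring,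
    Ring.choose_natCast, Units.smul_def, smul_eq_mul, Int.coe_negOnePow_natCast]

theorem prodTerm_zero (A B : VertexOperator ℂ V) (j : ℕ) : prodTerm 0 A B j =
    leftMul (ncoeff A (-1 - j)) (shift j B) + rightMul (ncoeff A j) (shift (-1 - j) B) := by
  have hchoose : Ring.choose (-1 : ℤ) j = (-1) ^ j := by
    simpa using choose_neg_one_sub_natCast 0 j
  simp [prodTerm, hchoose, ← mul_pow, sub_eq_add_neg]

theorem ncoeff_prod (p : ℤ) (A B : VertexOperator ℂ V) (m : ℤ) (v : V) :
    ncoeff (prod p A B) m v = ∑ᶠ j : ℕ, resTerm (p - 1) A B m j v := by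
  rw [prod, ncoeff_ofModes]
  rfl

/-- Convergence of fields to zero: on every vector and every set of indices bounded below, the
modes of `R J` vanish for large `J`. -/
def TendstoZero (R : ℕ → VertexOperator ℂ V) : Prop :=
  ∀ (m : ℤ) (v : V), ∀ᶠ J in atTop, ∀ n ≥ m, ncoeff (R J) n v = 0

theorem tendstoZero_shift (A : VertexOperator ℂ V) : TendstoZero fun J : ℕ => shift J A :=
  fun m v => by
    obtain ⟨M, hM⟩ := exists_ncoeff_eq_zero A v
    filter_upwards [eventually_ge_atTop (M - m).toNat] with J hJ n hn
    rw [ncoeff_shift]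
    exact hM _ (by omega)

theorem tendstoZero_prod_sub_sum (p : ℤ) (A B : VertexOperator ℂ V) :
    TendstoZero fun J => prod p A B - ∑ j ∈ Finset.range J, prodTerm p A B j := fun m v => by
  filter_upwards [tendstoZero_shift A 0 v, tendstoZero_shift B m v] with J hA hB n hn
  have hterm : ∀ j : ℕ, J ≤ j → resTerm (p - 1) A B n j v = 0 := fun j hj => by
    have hAj := hA (j - J) (by omega)
    have hBj := hB (n + (j - J)) (by omega)
    rw [ncoeff_shift, add_sub_cancel] at hAj
    rw [ncoeff_shift, show J + (n + (j - J)) = n + j by ring] at hBj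
    simp [resTerm, hAj, hBj]
  rw [map_sub, Pi.sub_apply, map_sum, Finset.sum_apply, LinearMap.sub_apply, LinearMap.sum_apply,
    sub_eq_zero, ncoeff_prod]
  simp only [ncoeff_prodTerm]
  refine finsum_eq_sum_of_support_subset _ fun j hj => ?_
  by_contra hjJ
  exact hj (hterm j (by simpa using hjJ))

theorem TendstoZero.eventually_forall_ncoeff_eq_zero {R : ℕ → VertexOperator ℂ V}
    (hR : TendstoZero R) (s : ℕ → ℤ) {w : ℕ → V} (hw : ∀ᶠ j in atTop, w j = 0) :
    ∀ᶠ J in atTop, ∀ j, ncoeff (R J) (s j) (w j) = 0 := by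
  obtain ⟨N, hN⟩ := eventually_atTop.mp hw
  filter_upwards [(Finset.range N).eventually_all.mpr fun j _ => hR (s j) (w j)] with J hJ j
  rcases lt_or_ge j N with hj | hj
  · exact hJ j (Finset.mem_range.mpr hj) _ le_rfl
  · rw [hN j hj, map_zero]

theorem eventually_ncoeff_natCast_add (A : VertexOperator ℂ V) (m : ℤ) (v : V) :
    ∀ᶠ j : ℕ in atTop, ncoeff A (m + j) v = 0 := by
  filter_upwards [tendstoZero_shift A m v] with j hj
  simpa [add_comm] using hj m le_rfl

theorem TendstoZero.eventually_ncoeff_prod_right {R : ℕ → VertexOperator ℂ V}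
    (hR : TendstoZero R) (p : ℤ) (A : VertexOperator ℂ V) (m : ℤ) (v : V) :
    ∀ᶠ J in atTop, ncoeff (prod p A (R J)) m v = 0 := by
  filter_upwards [hR m v, hR.eventually_forall_ncoeff_eq_zero (fun j => m + (p - 1) - j)
    (eventually_ncoeff_natCast_add A 0 v)] with J h₁ h₂
  rw [ncoeff_prod]
  refine (finsum_congr fun j => ?_).trans finsum_zero
  have := h₁ (m + j) (by omega)
  simp_all [resTerm]

theorem TendstoZero.eventually_ncoeff_prod_left {R : ℕ → VertexOperator ℂ V}
    (hR : TendstoZero R) (p : ℤ) (B : VertexOperator ℂ V) (m : ℤ) (v : V) :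
    ∀ᶠ J in atTop, ncoeff (prod p (R J) B) m v = 0 := by
  filter_upwards [hR 0 v, hR.eventually_forall_ncoeff_eq_zero (fun j => p - 1 - j)
    (eventually_ncoeff_natCast_add B m v)] with J h₁ h₂
  rw [ncoeff_prod]
  refine (finsum_congr fun j => ?_).trans finsum_zero
  have := h₁ j (by omega)
  simp_all [resTerm]

theorem eventually_ncoeff_prod (p : ℤ) (A B : VertexOperator ℂ V) (m : ℤ) (v : V) :
    ∀ᶠ J in atTop, ncoeff (prod p A B) m v =
      ∑ j ∈ Finset.range J, resTerm (p - 1) A B m j v := by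
  filter_upwards [tendstoZero_prod_sub_sum p A B m v] with J hJ
  have := hJ m le_rfl
  rw [map_sub, Pi.sub_apply, map_sum, Finset.sum_apply, LinearMap.sub_apply, LinearMap.sum_apply,
    sub_eq_zero] at this
  simpa only [ncoeff_prodTerm] using this

/-- The product `(A B)_p` as a bilinear map. -/
def prodLin (p : ℤ) :
    VertexOperator ℂ V →ₗ[ℂ] VertexOperator ℂ V →ₗ[ℂ] VertexOperator ℂ V :=
  LinearMap.mk₂ ℂ (prod p)
    (fun A A' B => field_ext fun m v => by
      simp only [map_add, Pi.add_apply, LinearMap.add_apply, ncoeff_prod]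
      refine (finsum_congr fun j => ?_).trans
        (finsum_add_distrib (resTerm_support_finite ..) (resTerm_support_finite ..))
      simp only [resTerm, map_add, Pi.add_apply, LinearMap.smul_apply, LinearMap.sub_apply,
        LinearMap.add_apply, Module.End.mul_apply]
      module)
    (fun c A B => field_ext fun m v => by
      simp only [map_smul, Pi.smul_apply, LinearMap.smul_apply, ncoeff_prod]
      rw [smul_finsum]
      refine finsum_congr fun j => ?_
      simp only [resTerm, map_smul, Pi.smul_apply, LinearMap.smul_apply, LinearMap.sub_apply,
        Module.End.mul_apply]
      module)
    (fun A B B' => field_ext fun m v => by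
      simp only [map_add, Pi.add_apply, LinearMap.add_apply, ncoeff_prod]
      refine (finsum_congr fun j => ?_).trans
        (finsum_add_distrib (resTerm_support_finite ..) (resTerm_support_finite ..))
      simp only [resTerm, map_add, Pi.add_apply, LinearMap.smul_apply, LinearMap.sub_apply,
        LinearMap.add_apply, Module.End.mul_apply]
      module)
    (fun c A B => field_ext fun m v => by
      simp only [map_smul, Pi.smul_apply, LinearMap.smul_apply, ncoeff_prod]
      rw [smul_finsum]
      refine finsum_congr fun j => ?_
      simp only [resTerm, map_smul, Pi.smul_apply, LinearMap.smul_apply, LinearMap.sub_apply,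
        Module.End.mul_apply]
      module)

theorem prod_add_left (p : ℤ) (A A' B : VertexOperator ℂ V) :
    prod p (A + A') B = prod p A B + prod p A' B :=
  (prodLin p).map_add₂ A A' B

theorem prod_add_right (p : ℤ) (A B B' : VertexOperator ℂ V) :
    prod p A (B + B') = prod p A B + prod p A B' :=
  (prodLin p A).map_add B B'

theorem prod_neg_left (p : ℤ) (A B : VertexOperator ℂ V) : prod p (-A) B = -prod p A B :=
  (prodLin p).map_neg₂ A B

theorem prod_neg_right (p : ℤ) (A B : VertexOperator ℂ V) : prod p A (-B) = -prod p A B :=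
  (prodLin p A).map_neg B

theorem prod_zsmul_left (p n : ℤ) (A B : VertexOperator ℂ V) :
    prod p (n • A) B = n • prod p A B :=
  map_zsmul ((prodLin p).flip B) n A

theorem prod_zsmul_right (p n : ℤ) (A B : VertexOperator ℂ V) :
    prod p A (n • B) = n • prod p A B :=
  map_zsmul (prodLin p A) n B

theorem prod_smul_left (p : ℤ) (c : ℂ) (A B : VertexOperator ℂ V) :
    prod p (c • A) B = c • prod p A B :=
  (prodLin p).map_smul₂ c A B

theorem prod_smul_right (p : ℤ) (c : ℂ) (A B : VertexOperator ℂ V) :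
    prod p A (c • B) = c • prod p A B :=
  (prodLin p A).map_smul c B

theorem zero_prod (p : ℤ) (A : VertexOperator ℂ V) : prod p 0 A = 0 :=
  (prodLin p).map_zero₂ A

theorem prod_zero (p : ℤ) (A : VertexOperator ℂ V) : prod p A 0 = 0 :=
  (prodLin p A).map_zero

theorem prod_sub_left (p : ℤ) (A A' B : VertexOperator ℂ V) :
    prod p (A - A') B = prod p A B - prod p A' B :=
  (prodLin p).map_sub₂ A A' B

theorem prod_sub_right (p : ℤ) (A B B' : VertexOperator ℂ V) :
    prod p A (B - B') = prod p A B - prod p A B' :=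
  (prodLin p A).map_sub B B'

theorem sum_prod (p : ℤ) (J : ℕ) (F : ℕ → VertexOperator ℂ V) (B : VertexOperator ℂ V) :
    prod p (∑ j ∈ Finset.range J, F j) B = ∑ j ∈ Finset.range J, prod p (F j) B :=
  map_sum ((prodLin p).flip B) F _

theorem prod_sum (p : ℤ) (J : ℕ) (A : VertexOperator ℂ V) (F : ℕ → VertexOperator ℂ V) :
    prod p A (∑ j ∈ Finset.range J, F j) = ∑ j ∈ Finset.range J, prod p A (F j) :=
  map_sum (prodLin p A) F _

theorem eventually_ncoeff_prod_prod_right (p q : ℤ) (A B C : VertexOperator ℂ V) (m : ℤ) (v : V) :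
    ∀ᶠ J in atTop, ncoeff (prod p A (prod q B C)) m v =
      ∑ j ∈ Finset.range J, ncoeff (prod p A (prodTerm q B C j)) m v := by
  filter_upwards [(tendstoZero_prod_sub_sum q B C).eventually_ncoeff_prod_right p A m v] with J hJ
  rw [prod_sub_right, prod_sum, map_sub, Pi.sub_apply, LinearMap.sub_apply, sub_eq_zero] at hJ
  rw [hJ, map_sum, Finset.sum_apply, LinearMap.sum_apply]

theorem eventually_ncoeff_prod_prod_left (p q : ℤ) (A B C : VertexOperator ℂ V) (m : ℤ) (v : V) :
    ∀ᶠ J in atTop, ncoeff (prod p (prod q A B) C) m v =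
      ∑ j ∈ Finset.range J, ncoeff (prod p (prodTerm q A B j) C) m v := by
  filter_upwards [(tendstoZero_prod_sub_sum q A B).eventually_ncoeff_prod_left p C m v] with J hJ
  rw [prod_sub_left, sum_prod, map_sub, Pi.sub_apply, LinearMap.sub_apply, sub_eq_zero] at hJ
  rw [hJ, map_sum, Finset.sum_apply, LinearMap.sum_apply]

theorem prod_shift_right (p s : ℤ) (A B : VertexOperator ℂ V) :
    prod p A (shift s B) = shift s (prod p A B) :=
  field_ext fun m v => by simp only [ncoeff_shift, ncoeff_prod, resTerm, add_assoc, add_sub_assoc]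

theorem ad_eq_zero_iff {T : Module.End ℂ V} : ad T A = 0 ↔ ∀ m, Commute T (ncoeff A m) := by
  refine ⟨fun h m => sub_eq_zero.mp ?_, fun h => field_ext fun m v => ?_⟩
  · rw [← ncoeff_ad, h, map_zero, Pi.zero_apply]
  · rw [ncoeff_ad, (h m).eq, sub_self, map_zero, Pi.zero_apply]

theorem prod_leftMul_right {T : Module.End ℂ V} (hT : ad T A = 0) (p : ℤ)
    (B : VertexOperator ℂ V) : prod p A (leftMul T B) = leftMul T (prod p A B) :=
  field_ext fun m v => by
    have hAT (n : ℤ) (w : V) : ncoeff A n (T w) = T (ncoeff A n w) :=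
      (LinearMap.congr_fun (ad_eq_zero_iff.mp hT n).eq w).symm
    obtain ⟨J, h₁, h₂⟩ := ((eventually_ncoeff_prod p A (leftMul T B) m v).and
      (eventually_ncoeff_prod p A B m v)).exists
    rw [ncoeff_leftMul, Module.End.mul_apply, h₁, h₂, map_sum]
    refine Finset.sum_congr rfl fun j _ => ?_
    simp only [resTerm, ncoeff_leftMul, LinearMap.smul_apply, LinearMap.sub_apply,
      Module.End.mul_apply, map_zsmul, map_sub, hAT]

theorem prod_rightMul_right {T : Module.End ℂ V} (hT : ad T A = 0) (p : ℤ)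
    (B : VertexOperator ℂ V) : prod p A (rightMul T B) = rightMul T (prod p A B) :=
  field_ext fun m v => by
    have hAT (n : ℤ) (w : V) : ncoeff A n (T w) = T (ncoeff A n w) :=
      (LinearMap.congr_fun (ad_eq_zero_iff.mp hT n).eq w).symm
    rw [ncoeff_rightMul, Module.End.mul_apply, ncoeff_prod, ncoeff_prod]
    exact finsum_congr fun j => by simp [resTerm, hAT]

theorem prod_prodTerm_right (p q : ℤ) (hAB : ∀ m n, Commute (ncoeff A m) (ncoeff B n)) (j : ℕ) :
    prod p A (prodTerm q B C j) = prodTerm q B (prod p A C) j := by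
  have had (n : ℤ) : ad (ncoeff B n) A = 0 := ad_eq_zero_iff.mpr fun m => (hAB m n).symm
  simp only [prodTerm, prod_zsmul_right, prod_sub_right, prod_leftMul_right (had _),
    prod_rightMul_right (had _), prod_shift_right]

theorem prod_left_comm (p q : ℤ) (hAB : SimplePoleOPE A B 0) :
    prod p A (prod q B C) = prod q B (prod p A C) := field_ext fun m v => by
  obtain ⟨J, h₁, h₂⟩ := ((eventually_ncoeff_prod_prod_right p q A B C m v).and
    (eventually_ncoeff_prod q B (prod p A C) m v)).exists
  rw [h₁, h₂]
  refine Finset.sum_congr rfl fun j _ => ?_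
  rw [prod_prodTerm_right p q fun m n => sub_eq_zero.mp (by simpa using hAB m n), ncoeff_prodTerm]

end Products

section BinomialSums

variable {M : Type*} [AddCommGroup M]

/-- The binomial sum `∑ j, (-1) ^ j * choose k j • x j`, for a finitely supported `x`: the
expansion of `(z - w) ^ k` paired with a sequence. -/
def binomSum (k : ℤ) (x : ℕ → M) : M :=
  ∑ᶠ j : ℕ, ((-1 : ℤ) ^ j * Ring.choose k j) • x j

theorem eventually_binomSum (k : ℤ) {x : ℕ → M} (hx : ∀ᶠ j in atTop, x j = 0) :
    ∀ᶠ J in atTop, binomSum k x =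
      ∑ j ∈ Finset.range J, ((-1 : ℤ) ^ j * Ring.choose k j) • x j := by
  filter_upwards [eventually_forall_ge_atTop.mpr hx] with J hJ
  refine finsum_eq_sum_of_support_subset _ fun j hj => ?_
  by_contra hjJ
  exact hj (by simp [hJ j (by simpa using hjJ)])

theorem binomSum_add_one (k : ℤ) {x : ℕ → M} (hx : ∀ᶠ j in atTop, x j = 0) :
    binomSum (k + 1) x = binomSum k x - binomSum k fun j => x (j + 1) := by
  have hx' : ∀ᶠ j in atTop, x (j + 1) = 0 := (tendsto_add_atTop_nat 1).eventually hx
  have hsucc (l : ℤ) := (tendsto_add_atTop_nat 1).eventually (eventually_binomSum l hx)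
  obtain ⟨J, h₁, h₂, h₃⟩ :=
    ((hsucc (k + 1)).and ((hsucc k).and (eventually_binomSum k hx'))).exists
  rw [h₁, h₂, h₃, Finset.sum_range_succ', Finset.sum_range_succ' _ J, add_sub_right_comm,
    ← Finset.sum_sub_distrib]
  congr 1
  · refine Finset.sum_congr rfl fun j _ => ?_
    rw [Ring.choose_succ_succ, pow_succ]
    module
  · simp

end BinomialSums

section Expansions

variable {V : Type*} [AddCommGroup V] [Module ℂ V] {A B : VertexOperator ℂ V}
  {m : ℤ} {v : V}

/-- The mode `m` of `∮ dz/(2πi) (z - w) ^ (p - 1) A(z) B(w)` over `|z| > |w|`. -/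
def outer (p : ℤ) (A B : VertexOperator ℂ V) (m : ℤ) (v : V) : V :=
  binomSum (p - 1) fun j => ncoeff A (p - 1 - j) (ncoeff B (m + j) v)

/-- The mode `m` of `∮ dz/(2πi) (z - w) ^ (p - 1) B(w) A(z)` over `|z| < |w|`. -/
def inner (p : ℤ) (A B : VertexOperator ℂ V) (m : ℤ) (v : V) : V :=
  (Int.negOnePow (p - 1) : ℤ) •
    binomSum (p - 1) fun j => ncoeff B (m + (p - 1) - j) (ncoeff A j v)

theorem eventually_outer_summand_eq_zero (p : ℤ) (A B : VertexOperator ℂ V) (m : ℤ) (v : V) :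
    ∀ᶠ j : ℕ in atTop, ncoeff A (p - 1 - j) (ncoeff B (m + j) v) = 0 := by
  filter_upwards [eventually_ncoeff_natCast_add B m v] with j hj
  rw [hj, map_zero]

theorem eventually_inner_summand_eq_zero (p : ℤ) (A B : VertexOperator ℂ V) (m : ℤ) (v : V) :
    ∀ᶠ j : ℕ in atTop, ncoeff B (m + (p - 1) - j) (ncoeff A j v) = 0 := by
  filter_upwards [eventually_ncoeff_natCast_add A 0 v] with j hj
  rw [← zero_add (j : ℤ), hj, map_zero]

theorem outer_eq_zero (hB : ∀ n ≥ m, ncoeff B n v = 0) (p : ℤ) (A : VertexOperator ℂ V) :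
    outer p A B m v = 0 := by
  simp [outer, binomSum, hB]

theorem inner_eq_zero (hA : ∀ n ≥ 0, ncoeff A n v = 0) (p : ℤ) (B : VertexOperator ℂ V) (m : ℤ) :
    inner p A B m v = 0 := by
  simp [inner, binomSum, hA]

theorem ncoeff_prod_eq_outer_sub_inner (p : ℤ) (A B : VertexOperator ℂ V) (m : ℤ) (v : V) :
    ncoeff (prod p A B) m v = outer p A B m v - inner p A B m v := by
  obtain ⟨J, h₁, h₂, h₃⟩ := ((eventually_ncoeff_prod p A B m v).and <|
    (eventually_binomSum (p - 1) (eventually_outer_summand_eq_zero p A B m v)).and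
    (eventually_binomSum (p - 1) (eventually_inner_summand_eq_zero p A B m v))).exists
  rw [h₁, outer, inner, h₂, h₃, Finset.smul_sum, ← Finset.sum_sub_distrib]
  refine Finset.sum_congr rfl fun j _ => ?_
  simp only [resTerm, LinearMap.smul_apply, LinearMap.sub_apply, Module.End.mul_apply]
  module

theorem outer_add_one (p : ℤ) (A B : VertexOperator ℂ V) (m : ℤ) (v : V) :
    outer (p + 1) A B m v = outer p (shift 1 A) B m v - outer p A (shift 1 B) m v := by
  rw [outer, add_sub_right_comm, binomSum_add_one _
    (by simpa only [add_sub_right_comm] using eventually_outer_summand_eq_zero (p + 1) A B m v)]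
  congr 2 with j
  · rw [ncoeff_shift, ← add_sub_assoc, add_comm 1]
  · rw [ncoeff_shift, add_left_comm, add_comm 1, Nat.cast_succ, add_sub_add_right_eq_sub]

theorem inner_add_one (p : ℤ) (A B : VertexOperator ℂ V) (m : ℤ) (v : V) :
    inner (p + 1) A B m v = inner p (shift 1 A) B m v - inner p A (shift 1 B) m v := by
  rw [inner, add_sub_right_comm, binomSum_add_one _
    (by simpa only [add_sub_right_comm] using eventually_inner_summand_eq_zero (p + 1) A B m v),
    Int.negOnePow_succ, Units.val_neg, neg_smul, ← smul_neg, neg_sub, smul_sub]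
  congr 3 with j
  · rw [ncoeff_shift, Nat.cast_succ, add_comm 1, ← add_assoc, add_sub_add_right_eq_sub]
  · rw [ncoeff_shift, show 1 + (m + (p - 1) - j) = m + (p - 1 + 1) - j by ring]

/-- The residue form of `(z - w) ^ (k + 1) = z * (z - w) ^ k - w * (z - w) ^ k`. -/
theorem prod_add_one (p : ℤ) (A B : VertexOperator ℂ V) :
    prod (p + 1) A B = prod p (shift 1 A) B - shift 1 (prod p A B) := field_ext fun m v => by
  rw [← prod_shift_right, map_sub, Pi.sub_apply, LinearMap.sub_apply]
  simp only [ncoeff_prod_eq_outer_sub_inner, outer_add_one, inner_add_one]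
  abel

theorem ncoeff_prod_leftMul_left (T : Module.End ℂ V) (p : ℤ) (A B : VertexOperator ℂ V) (m : ℤ)
    (v : V) : ncoeff (prod p (leftMul T A) B) m v =
      T (ncoeff (prod p A B) m v) + inner p A (ad T B) m v := by
  obtain ⟨J, h₁, h₂, h₃⟩ := ((eventually_ncoeff_prod p (leftMul T A) B m v).and <|
    (eventually_ncoeff_prod p A B m v).and
    (eventually_binomSum (p - 1) (eventually_inner_summand_eq_zero p A (ad T B) m v))).exists
  rw [h₁, h₂, inner, h₃, map_sum, Finset.smul_sum, ← Finset.sum_add_distrib]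
  refine Finset.sum_congr rfl fun j _ => ?_
  simp only [resTerm, LinearMap.smul_apply, LinearMap.sub_apply, Module.End.mul_apply,
    ncoeff_leftMul, ncoeff_ad, map_zsmul, map_sub]
  module

theorem ncoeff_prod_rightMul_left (T : Module.End ℂ V) (p : ℤ) (A B : VertexOperator ℂ V) (m : ℤ)
    (v : V) : ncoeff (prod p (rightMul T A) B) m v =
      ncoeff (prod p A B) m (T v) + outer p A (ad T B) m v := by
  obtain ⟨J, h₁, h₂, h₃⟩ := ((eventually_ncoeff_prod p (rightMul T A) B m v).and <|
    (eventually_ncoeff_prod p A B m (T v)).and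
    (eventually_binomSum (p - 1) (eventually_outer_summand_eq_zero p A (ad T B) m v))).exists
  rw [h₁, h₂, outer, h₃, ← Finset.sum_add_distrib]
  refine Finset.sum_congr rfl fun j _ => ?_
  simp only [resTerm, LinearMap.smul_apply, LinearMap.sub_apply, Module.End.mul_apply,
    ncoeff_rightMul, ncoeff_ad, map_sub]
  module

end Expansions

section Taylor

variable {V : Type*} [AddCommGroup V] [Module ℂ V] {A B : VertexOperator ℂ V}

theorem resTerm_ad (T : Module.End ℂ V) (k : ℤ) (A B : VertexOperator ℂ V) (m : ℤ) (j : ℕ) :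
    T * resTerm k A B m j - resTerm k A B m j * T =
      resTerm k (ad T A) B m j + resTerm k A (ad T B) m j := by
  simp only [resTerm, ncoeff_ad, mul_smul_comm, smul_mul_assoc, mul_sub, sub_mul, smul_sub,
    mul_assoc]
  abel

theorem ad_prod (T : Module.End ℂ V) (p : ℤ) (A B : VertexOperator ℂ V) :
    ad T (prod p A B) = prod p (ad T A) B + prod p A (ad T B) := field_ext fun m v => by
  simp only [ncoeff_ad, map_add, Pi.add_apply, LinearMap.sub_apply, LinearMap.add_apply,
    Module.End.mul_apply, ncoeff_prod]
  obtain ⟨J, h₁, h₂, h₃, h₄⟩ := ((eventually_ncoeff_prod p A B m v).and <|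
    (eventually_ncoeff_prod p A B m (T v)).and <| (eventually_ncoeff_prod p (ad T A) B m v).and
    (eventually_ncoeff_prod p A (ad T B) m v)).exists
  simp only [ncoeff_prod] at h₁ h₂ h₃ h₄
  rw [h₁, h₂, h₃, h₄, map_sum, ← Finset.sum_sub_distrib, ← Finset.sum_add_distrib]
  exact Finset.sum_congr rfl fun j _ => LinearMap.congr_fun (resTerm_ad T (p - 1) A B m j) v

theorem prod_one_shift_left (m : ℤ) (A B : VertexOperator ℂ V) :
    prod 1 (shift m A) B = ad (ncoeff A m) B := field_ext fun n v => by
  rw [ncoeff_prod]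
  refine (finsum_eq_single _ 0 fun j hj => ?_).trans ?_
  · simp [resTerm, Ring.choose_zero_pos ℤ (Nat.pos_of_ne_zero hj)]
  · simp [resTerm]

/-- The OPE of `A` and `B` has poles of order at most `K`: the residues of
`z ^ s * (z - w) ^ K * A(z) B(w)` vanish for all `s`. -/
def IsLocal (K : ℤ) (A B : VertexOperator ℂ V) : Prop :=
  ∀ s, prod (K + 1) (shift s A) B = 0

theorem IsLocal.prod_shift_eq_zero {K : ℤ} (h : IsLocal K A B) {p : ℤ} (hp : K < p) (s : ℤ) :
    prod p (shift s A) B = 0 := by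
  induction p, hp using Int.leInduction generalizing s with
  | base => exact h s
  | succ p _ ih => rw [prod_add_one, shift_shift, ih, ih, map_zero, sub_zero]

theorem IsLocal.prod_eq_zero {K : ℤ} (h : IsLocal K A B) {p : ℤ} (hp : K < p) :
    prod p A B = 0 := by
  simpa using h.prod_shift_eq_zero hp 0

theorem sum_choose_succ_smul_shift (P : ℕ → VertexOperator ℂ V) (M : ℕ) (s : ℤ) :
    ∑ j ∈ Finset.range (M + 1), Ring.choose (s + 1) j • shift (s + 1 - j) (P j) =
      ∑ j ∈ Finset.range M, Ring.choose s j • shift (s - j) (P (j + 1)) +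
        shift 1 (∑ j ∈ Finset.range (M + 1), Ring.choose s j • shift (s - j) (P j)) := by
  have hshift (j : ℤ) : 1 + (s - j) = s + 1 - j := by ring
  simp only [map_add, map_sum, map_zsmul, shift_shift, hshift, Finset.sum_range_succ' _ M,
    Ring.choose_succ_succ, add_smul, Finset.sum_add_distrib, Ring.choose_zero_right, Nat.cast_add,
    Nat.cast_one, add_sub_add_right_eq_sub, add_assoc]

/-- The residue form of Taylor's formula `z ^ s = ∑ j, choose s j * w ^ (s - j) * (z - w) ^ j`. -/
theorem prod_shift_left {M : ℕ} {p : ℤ} (h : IsLocal (p + M - 1) A B) (s : ℤ) :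
    prod p (shift s A) B =
      ∑ j ∈ Finset.range M, Ring.choose s j • shift (s - j) (prod (p + j) A B) := by
  induction M generalizing p s with
  | zero => simpa using h.prod_shift_eq_zero (p := p) (by simp) s
  | succ M ih =>
    have hprod (s : ℤ) :
        prod p (shift (s + 1) A) B =
          prod (p + 1) (shift s A) B + shift 1 (prod p (shift s A) B) := by
      rw [prod_add_one, shift_shift, add_comm 1 s, sub_add_cancel]
    have hsum (s : ℤ) :
        ∑ j ∈ Finset.range (M + 1), Ring.choose (s + 1) j • shift (s + 1 - j) (prod (p + j) A B) =
          prod (p + 1) (shift s A) B + shift 1 (∑ j ∈ Finset.range (M + 1),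
            Ring.choose s j • shift (s - j) (prod (p + j) A B)) := by
      rw [sum_choose_succ_smul_shift, ih (p := p + 1) (by convert h using 1; push_cast; ring)]
      simp only [Nat.cast_add, Nat.cast_one, add_assoc, add_comm (1 : ℤ)]
    induction s with
    | zero => simp [Finset.sum_range_succ', Ring.choose_zero_succ]
    | succ s ih => rw [hprod, hsum, ih]
    | pred s ih =>
      apply shift_injective 1
      rw [← add_right_inj, ← hprod, ← hsum, sub_add_cancel, ih]

end Taylor

section OPE

variable {V : Type*} [AddCommGroup V] [Module ℂ V]
  {A B C D D₁ D₂ E E₁ E₂ F G H : VertexOperator ℂ V}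

theorem simplePoleOPE_zero_left (A : VertexOperator ℂ V) : SimplePoleOPE 0 A 0 :=
  fun m n => by simp

theorem simplePoleOPE_zero_right (A : VertexOperator ℂ V) : SimplePoleOPE A 0 0 :=
  fun m n => by simp

theorem SimplePoleOPE.symm (h : SimplePoleOPE A B C) : SimplePoleOPE B A (-C) := fun m n => by
  rw [map_neg, Pi.neg_apply, add_comm, ← h n m, neg_sub]

theorem SimplePoleOPE.symm_zero (h : SimplePoleOPE A B 0) : SimplePoleOPE B A 0 := by
  simpa using h.symm

theorem simplePoleOPE_iff_ad :
    SimplePoleOPE A B C ↔ ∀ m, ad (ncoeff A m) B = shift m C := by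
  refine ⟨fun h m => field_ext fun n v => ?_, fun h m n => ?_⟩
  · rw [ncoeff_ad, ncoeff_shift, h m n]
  · rw [← ncoeff_ad, h m, ncoeff_shift]

theorem SimplePoleOPE.ad_eq (h : SimplePoleOPE A B C) (m : ℤ) :
    ad (ncoeff A m) B = shift m C :=
  simplePoleOPE_iff_ad.mp h m

theorem SimplePoleOPE.add_right (hB : SimplePoleOPE A B D) (hC : SimplePoleOPE A C E) :
    SimplePoleOPE A (B + C) (D + E) :=
  simplePoleOPE_iff_ad.mpr fun m => by rw [map_add, map_add, hB.ad_eq, hC.ad_eq]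

theorem SimplePoleOPE.neg_right (h : SimplePoleOPE A B C) : SimplePoleOPE A (-B) (-C) :=
  simplePoleOPE_iff_ad.mpr fun m => by rw [map_neg, map_neg, h.ad_eq]

theorem SimplePoleOPE.prod_one (h : SimplePoleOPE A B C) : prod 1 A B = C := by
  simpa [h.ad_eq] using prod_one_shift_left 0 A B

theorem SimplePoleOPE.eq_zero_of_self (h : SimplePoleOPE A A C) : C = 0 := by
  have := IsAddTorsionFree.of_isTorsionFree ℂ (VertexOperator ℂ V)
  exact self_eq_neg.mp (h.prod_one.symm.trans h.symm.prod_one)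

theorem SimplePoleOPE.isLocal_one (h : SimplePoleOPE A B C) : IsLocal 1 A B := fun s => by
  rw [prod_add_one, shift_shift, prod_one_shift_left, prod_one_shift_left, h.ad_eq, h.ad_eq,
    shift_shift, sub_self]

theorem SimplePoleOPE.isLocal_zero (h : SimplePoleOPE A B 0) : IsLocal 0 A B := fun s => by
  rw [zero_add, prod_one_shift_left, h.ad_eq, map_zero]

theorem SimplePoleOPE.prod_zero_shift_left (h : SimplePoleOPE A B C) (m : ℤ) :
    prod 0 (shift m A) B = shift m (prod 0 A B) + m • shift (m - 1) C := by
  rw [prod_shift_left (M := 2) (by simpa using h.isLocal_one) m]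
  simp [Finset.sum_range_succ, h.prod_one]

theorem SimplePoleOPE.prod_right (hB : SimplePoleOPE A B 0) (hC : SimplePoleOPE A C 0) (p : ℤ) :
    SimplePoleOPE A (prod p B C) 0 :=
  simplePoleOPE_iff_ad.mpr fun m => by
    rw [ad_prod, hB.ad_eq, hC.ad_eq, map_zero, zero_prod, prod_zero, add_zero]

/-- Jacobi's identity for modes, with `D`, `E`, `F`, `G`, `H` the poles of `A B`, `B C`, `A C`,
`A E` and `B F`. -/
theorem SimplePoleOPE.jacobi (hAB : SimplePoleOPE A B D) (hBC : SimplePoleOPE B C E)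
    (hAC : SimplePoleOPE A C F) (hAE : SimplePoleOPE A E G) (hBF : SimplePoleOPE B F H) :
    SimplePoleOPE D C (G - H) := fun m n => by
  have hD := hAB m 0
  have hG := hAE m n
  have hH := hBF 0 (m + n)
  rw [← zero_add n, ← hBC 0 n] at hG
  rw [← hAC m n] at hH
  rw [add_zero] at hD
  rw [map_sub, Pi.sub_apply, ← hD]
  rw [zero_add] at hG hH
  rw [← hG, ← hH]
  noncomm_ring

/-- The operator product expansion `A(z) B(w) ∼ E(w) / (z - w) ^ 2 + D(w) / (z - w)`,
encoded by `[A_(m), B(w)] = w ^ m * D(w) + m * w ^ (m - 1) * E(w)`. -/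
def DoublePoleOPE (A B D E : VertexOperator ℂ V) : Prop :=
  ∀ m : ℤ, ad (ncoeff A m) B = shift m D + m • shift (m - 1) E

theorem doublePoleOPE_zero_iff : DoublePoleOPE A B D 0 ↔ SimplePoleOPE A B D := by
  simp [DoublePoleOPE, simplePoleOPE_iff_ad]

theorem SimplePoleOPE.doublePoleOPE (h : SimplePoleOPE A B D) : DoublePoleOPE A B D 0 :=
  doublePoleOPE_zero_iff.mpr h

theorem DoublePoleOPE.add_right (hB : DoublePoleOPE A B D₁ E₁) (hC : DoublePoleOPE A C D₂ E₂) :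
    DoublePoleOPE A (B + C) (D₁ + D₂) (E₁ + E₂) := fun m => by
  simp only [map_add, hB m, hC m, smul_add]
  abel

theorem DoublePoleOPE.neg_right (h : DoublePoleOPE A B D E) :
    DoublePoleOPE A (-B) (-D) (-E) := fun m => by
  simp only [map_neg, h m, smul_neg, neg_add]

theorem DoublePoleOPE.symm {c : ℂ} (h : DoublePoleOPE A B D (c • idField)) :
    DoublePoleOPE B A (-D) (c • idField) := fun n => field_ext fun m v => by
  have hmn := congrArg (fun F => ncoeff F n v) (h m)
  have hid : m • ncoeff (idField (V := V)) (m - 1 + n) v = -(n • ncoeff idField (n - 1 + m) v) := by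
    by_cases hmn : m - 1 + n = -1
    · rw [show n = -m by omega, show -m - 1 + m = m - 1 + -m by ring]; module
    · simp [idField, hmn, show n - 1 + m ≠ -1 by omega]
  simp only [ncoeff_ad, map_add, map_zsmul, map_smul, Pi.add_apply, Pi.smul_apply, ncoeff_shift,
    map_neg, Pi.neg_apply, LinearMap.sub_apply, LinearMap.add_apply, LinearMap.smul_apply,
    LinearMap.neg_apply, smul_comm _ c, hid] at hmn ⊢
  rw [← neg_sub, hmn, add_comm n m, neg_add, smul_neg, neg_neg]

theorem DoublePoleOPE.prod_zero_right (hB : DoublePoleOPE A B D₁ E₁) (hC : DoublePoleOPE A C D₂ E₂)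
    (hDC : SimplePoleOPE D₁ C G) (hEC : SimplePoleOPE E₁ C 0) :
    DoublePoleOPE A (prod 0 B C) (prod 0 D₁ C + prod 0 B D₂)
      (G + prod 0 E₁ C + prod 0 B E₂) := fun m => by
  have hleft : prod 0 (m • shift (m - 1) E₁) C = m • shift (m - 1) (prod 0 E₁ C) := by
    rw [prod_zsmul_left, hEC.prod_zero_shift_left, map_zero, smul_zero, add_zero]
  have hright : prod 0 B (m • shift (m - 1) E₂) = m • shift (m - 1) (prod 0 B E₂) := by
    rw [prod_zsmul_right, prod_shift_right]
  rw [ad_prod, hB m, hC m, prod_add_left, prod_add_right, hleft, hright,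
    hDC.prod_zero_shift_left, prod_shift_right]
  simp only [map_add, smul_add]
  abel

theorem DoublePoleOPE.simplePoleOPE (h : DoublePoleOPE A B D E) (hE : E = 0) :
    SimplePoleOPE A B D :=
  doublePoleOPE_zero_iff.mp (hE ▸ h)

theorem SimplePoleOPE.prod_zero_right (hB : SimplePoleOPE A B D) (hC : SimplePoleOPE A C E)
    (hDC : SimplePoleOPE D C 0) : SimplePoleOPE A (prod 0 B C) (prod 0 D C + prod 0 B E) := by
  refine (hB.doublePoleOPE.prod_zero_right hC.doublePoleOPE hDC
    (simplePoleOPE_zero_left C)).simplePoleOPE ?_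
  rw [zero_prod, prod_zero, add_zero, add_zero]

theorem ncoeff_prod_zero (A B : VertexOperator ℂ V) (m : ℤ) (v : V) :
    ncoeff (prod 0 A B) m v = ∑ᶠ j : ℕ,
      (ncoeff A (-1 - j) (ncoeff B (j + m) v) + ncoeff B (-1 - j + m) (ncoeff A j v)) := by
  rw [ncoeff_prod]
  refine finsum_congr fun j => ?_
  rw [← ncoeff_prodTerm, prodTerm_zero]
  simp

theorem ncoeff_idField (m : ℤ) (v : V) : ncoeff idField m v = if m = -1 then v else 0 := by
  rw [idField, ncoeff_ofModes]
  split_ifs <;> rfl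

theorem idField_prod (A : VertexOperator ℂ V) : prod 0 idField A = A := field_ext fun m v => by
  rw [ncoeff_prod_zero]
  refine (finsum_eq_single _ 0 fun j hj => ?_).trans ?_
  · simp [ncoeff_idField, hj, show (j : ℤ) ≠ -1 by omega]
  · simp [ncoeff_idField]

theorem prod_idField (A : VertexOperator ℂ V) : prod 0 A idField = A := field_ext fun m v => by
  rw [ncoeff_prod_zero]
  rcases le_or_gt 0 m with hm | hm
  · lift m to ℕ using hm
    refine (finsum_eq_single _ m fun j hj => ?_).trans ?_
    · simp [ncoeff_idField, show (j : ℤ) + m ≠ -1 by omega, show -1 - (j : ℤ) + m ≠ -1 by omega]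
    · simp [ncoeff_idField, show (m : ℤ) + m ≠ -1 by omega]
  · obtain ⟨k, rfl⟩ : ∃ k : ℕ, m = -1 - k := ⟨(-1 - m).toNat, by omega⟩
    refine (finsum_eq_single _ k fun j hj => ?_).trans ?_
    · simp [ncoeff_idField, show (j : ℤ) + (-1 - k) ≠ -1 by omega,
        show -1 - (j : ℤ) + (-1 - k) ≠ -1 by omega]
    · simp [ncoeff_idField, show -1 - (k : ℤ) + (-1 - k) ≠ -1 by omega]

theorem simplePoleOPE_idField_right (A : VertexOperator ℂ V) : SimplePoleOPE A idField 0 :=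
  fun m n => by
    rw [idField, ncoeff_ofModes]
    split_ifs <;> simp

theorem simplePoleOPE_smul_idField_left (c : ℂ) (A : VertexOperator ℂ V) :
    SimplePoleOPE (c • idField) A 0 := fun m n => by
  rw [map_smul, Pi.smul_apply, smul_mul_assoc, mul_smul_comm, ← smul_sub,
    (simplePoleOPE_idField_right A).symm_zero m n]
  simp

theorem simplePoleOPE_neg_idField_left (A : VertexOperator ℂ V) : SimplePoleOPE (-idField) A 0 := by
  simpa using (simplePoleOPE_idField_right A).neg_right.symm

end OPE

section QuasiAssociativity

variable {V : Type*} [AddCommGroup V] [Module ℂ V] {A B G H : VertexOperator ℂ V}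

theorem SimplePoleOPE.ncoeff_prod_prodTerm_zero (hAG : SimplePoleOPE A G H) (p : ℤ)
    (B : VertexOperator ℂ V) (j : ℕ) (m : ℤ) (v : V) :
    ncoeff (prod p (prodTerm 0 A B j) G) m v =
      ncoeff A (-1 - j) (ncoeff (prod p (shift j B) G) m v) +
        ncoeff (prod p (shift (-1 - j) B) G) m (ncoeff A j v) +
        (inner p (shift j B) (shift (-1 - j) H) m v +
          outer p (shift (-1 - j) B) (shift j H) m v) := by
  rw [prodTerm_zero, prod_add_left, map_add, Pi.add_apply, LinearMap.add_apply,
    ncoeff_prod_leftMul_left, ncoeff_prod_rightMul_left, hAG.ad_eq, hAG.ad_eq]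
  abel

/-- By Pascal's rule the sum telescopes. -/
theorem eventually_sum_inner_add_outer (p : ℤ) (B H : VertexOperator ℂ V) (m : ℤ) (v : V) :
    ∀ᶠ J in atTop, ∑ j ∈ Finset.range J, (inner p (shift j B) (shift (-1 - j) H) m v +
      outer p (shift (-1 - j) B) (shift j H) m v) = ncoeff (prod (p - 1) B H) m v := by
  let f (j : ℕ) : V := inner (p - 1) (shift j B) (shift (-j) H) m v
  let g (j : ℕ) : V := outer (p - 1) (shift (-j) B) (shift j H) m v
  have hf : ∀ᶠ J in atTop, f J = 0 := by
    filter_upwards [tendstoZero_shift B 0 v] with J hJ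
    exact inner_eq_zero hJ _ _ m
  have hg : ∀ᶠ J in atTop, g J = 0 := by
    filter_upwards [tendstoZero_shift H m v] with J hJ
    exact outer_eq_zero hJ _ _
  have hterm (j : ℕ) : inner p (shift j B) (shift (-1 - j) H) m v +
      outer p (shift (-1 - j) B) (shift j H) m v = f (j + 1) - f j - (g (j + 1) - g j) := by
    obtain ⟨q, rfl⟩ : ∃ q, p = q + 1 := ⟨p - 1, by ring⟩
    rw [inner_add_one, outer_add_one]
    simp only [shift_shift, f, g, add_sub_cancel_right]
    rw [show (1 : ℤ) + j = (j + 1 : ℕ) by push_cast; ring,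
      show -1 - (j : ℤ) = -(j + 1 : ℕ) by push_cast; ring,
      show 1 + -((j + 1 : ℕ) : ℤ) = -j by push_cast; ring]
    abel
  filter_upwards [hf, hg] with J hfJ hgJ
  rw [Finset.sum_congr rfl fun j _ => hterm j, Finset.sum_sub_distrib, Finset.sum_range_sub,
    Finset.sum_range_sub, hfJ, hgJ, ncoeff_prod_eq_outer_sub_inner]
  simp [f, g, neg_add_eq_sub]

theorem eventually_outer_neg_natCast (j : ℕ) (A F : VertexOperator ℂ V) (m : ℤ) (v : V) :
    ∀ᶠ J in atTop, outer (-j) A F m v = ∑ i ∈ Finset.range J,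
      Ring.choose (i : ℤ) j • ncoeff A (-1 - i) (ncoeff (shift (i - j) F) m v) := by
  filter_upwards [eventually_ge_atTop j, (tendsto_sub_atTop_nat j).eventually
    (eventually_binomSum (-j - 1) (eventually_outer_summand_eq_zero (-j) A F m v))] with J hJ h
  obtain ⟨J, rfl⟩ := Nat.exists_eq_add_of_le hJ
  have hlow : ∀ i ∈ Finset.range j, Ring.choose (i : ℤ) j •
      ncoeff A (-1 - i) (ncoeff (shift (i - j) F) m v) = 0 := fun i hi => by
    rw [Ring.choose_natCast, Nat.choose_eq_zero_of_lt (Finset.mem_range.mp hi), Nat.cast_zero,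
      zero_smul]
  rw [outer, h, Finset.sum_range_add, Finset.sum_eq_zero hlow, zero_add, add_tsub_cancel_left]
  refine Finset.sum_congr rfl fun n _ => ?_
  have hchoose : (-1 : ℤ) ^ n * Ring.choose (-j - 1 : ℤ) n = Ring.choose ((j + n : ℕ) : ℤ) j := by
    rw [neg_sub_comm, choose_neg_one_sub_natCast, ← mul_assoc, ← mul_pow, neg_one_mul, neg_neg,
      one_pow, one_mul, Ring.choose_natCast, Nat.choose_symm_add]
  rw [hchoose, ncoeff_shift, show -j - 1 - (n : ℤ) = -1 - (j + n : ℕ) by push_cast; ring,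
    show (j + n : ℕ) - j + m = m + n by push_cast; ring]

theorem eventually_inner_neg_natCast (j : ℕ) (A F : VertexOperator ℂ V) (m : ℤ) (v : V) :
    ∀ᶠ J in atTop, inner (-j) A F m v = -∑ i ∈ Finset.range J,
      Ring.choose (-1 - i : ℤ) j • ncoeff (shift (-1 - i - j) F) m (ncoeff A i v) := by
  filter_upwards [eventually_binomSum (-j - 1)
    (eventually_inner_summand_eq_zero (-j) A F m v)] with J h
  rw [inner, h, Finset.smul_sum, ← Finset.sum_neg_distrib]
  refine Finset.sum_congr rfl fun i _ => ?_
  have hsign : (-1 : ℤ) ^ (2 * i) = 1 := Even.neg_one_pow (even_two_mul i)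
  have hchoose : (Int.negOnePow (-j - 1) : ℤ) * ((-1) ^ i * Ring.choose (-j - 1 : ℤ) i) =
      -Ring.choose (-1 - i : ℤ) j := by
    rw [neg_sub_comm, choose_neg_one_sub_natCast, choose_neg_one_sub_natCast]
    rw [Int.negOnePow_sub, Int.negOnePow_neg, Int.negOnePow_one, Units.val_mul,
      Int.coe_negOnePow_natCast, add_comm i j, Nat.choose_symm_add, Units.val_neg, Units.val_one]
    linear_combination (-(-1) ^ j * ((j + i).choose i : ℤ)) * hsign
  rw [smul_smul, hchoose, neg_smul, ncoeff_shift, show -1 - i - j + m = m + (-j - 1) - i by ring]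

theorem eventually_ncoeff_prod_neg_natCast (j : ℕ) (A F : VertexOperator ℂ V) (m : ℤ) (v : V) :
    ∀ᶠ J in atTop, ncoeff (prod (-j) A F) m v = ∑ i ∈ Finset.range J,
      (Ring.choose (i : ℤ) j • ncoeff A (-1 - i) (ncoeff (shift (i - j) F) m v) +
        Ring.choose (-1 - i : ℤ) j • ncoeff (shift (-1 - i - j) F) m (ncoeff A i v)) := by
  filter_upwards [eventually_outer_neg_natCast j A F m v,
    eventually_inner_neg_natCast j A F m v] with J h₁ h₂
  rw [ncoeff_prod_eq_outer_sub_inner, h₁, h₂, sub_neg_eq_add, Finset.sum_add_distrib]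

theorem SimplePoleOPE.prod_prod_zero_left_range (hAG : SimplePoleOPE A G H) {M : ℕ} {p : ℤ}
    (hBG : IsLocal (p + M - 1) B G) :
    prod p (prod 0 A B) G = prod (p - 1) B H +
      ∑ j ∈ Finset.range M, prod (-j) A (prod (p + j) B G) := field_ext fun m v => by
  obtain ⟨J, h₁, h₂, h₃⟩ := ((eventually_ncoeff_prod_prod_left p 0 A B G m v).and <|
    (eventually_sum_inner_add_outer p B H m v).and <|
    (Finset.range M).eventually_all.mpr fun j _ =>
      eventually_ncoeff_prod_neg_natCast j A (prod (p + j) B G) m v).exists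
  rw [h₁, Finset.sum_congr rfl fun j _ => hAG.ncoeff_prod_prodTerm_zero p B j m v,
    Finset.sum_add_distrib, h₂, map_add, Pi.add_apply, LinearMap.add_apply, add_comm, map_sum,
    Finset.sum_apply, LinearMap.sum_apply, Finset.sum_congr rfl h₃, Finset.sum_comm]
  congr 1
  refine Finset.sum_congr rfl fun i _ => ?_
  simp only [prod_shift_left hBG, map_sum, map_zsmul, Finset.sum_apply, Pi.smul_apply,
    LinearMap.sum_apply, LinearMap.smul_apply, Finset.sum_add_distrib]

end QuasiAssociativity

section Locality

variable {V : Type*} [AddCommGroup V] [Module ℂ V] {A B C D G H R : VertexOperator ℂ V} {K : ℤ}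

theorem IsLocal.mono (h : IsLocal K A B) {L : ℤ} (hKL : K ≤ L) : IsLocal L A B :=
  h.prod_shift_eq_zero (Int.lt_add_one_of_le hKL)

theorem IsLocal.shift_left (h : IsLocal K A B) (s : ℤ) : IsLocal K (shift s A) B := fun t => by
  rw [shift_shift, h]

theorem SimplePoleOPE.shift_left_zero (h : SimplePoleOPE A B 0) (s : ℤ) :
    SimplePoleOPE (shift s A) B 0 := fun m n => by
  simpa using h (s + m) n

theorem IsLocal.prod_right (hBD : IsLocal K B D) (hBC : SimplePoleOPE B C 0) (q : ℤ) :
    IsLocal K B (prod q C D) := fun s => by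
  rw [prod_left_comm _ _ (hBC.shift_left_zero s), hBD s, prod_zero]

theorem SimplePoleOPE.prod_prod_zero_left (hAG : SimplePoleOPE A G H) (hBG : IsLocal K B G)
    (p : ℤ) : prod p (prod 0 A B) G =
      prod (p - 1) B H + ∑ q ∈ Finset.Icc p K, prod (p - q) A (prod q B G) := by
  rw [hAG.prod_prod_zero_left_range (M := (K + 1 - p).toNat) (hBG.mono (by omega)),
    Int.Icc_eq_finset_map, Finset.sum_map]
  simp

theorem IsLocal.prod_zero_left (hBG : IsLocal K B G) (hAG : SimplePoleOPE A G H)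
    (hBH : IsLocal K B H) : IsLocal (K + 1) (prod 0 A B) G := fun s => by
  rw [← prod_shift_right, hAG.prod_prod_zero_left (hBG.shift_left s),
    Finset.Icc_eq_empty_of_lt (by omega), Finset.sum_empty, add_zero,
    hBH.prod_shift_eq_zero (by omega)]

theorem SimplePoleOPE.prod_zero_right_of_regular (hAC : SimplePoleOPE A C R)
    (hAD : SimplePoleOPE A D 0) (hRD : SimplePoleOPE R D 0) :
    SimplePoleOPE A (prod 0 C D) (prod 0 R D) := by
  simpa [prod_zero] using hAC.prod_zero_right hAD hRD

theorem IsLocal.prod_zero_prod_zero (hBD : IsLocal K B D) (hAC : SimplePoleOPE A C R)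
    (hAD : SimplePoleOPE A D 0) (hBC : SimplePoleOPE B C 0) (hBR : SimplePoleOPE B R 0)
    (hRD : SimplePoleOPE R D 0) : IsLocal (K + 1) (prod 0 A B) (prod 0 C D) :=
  (hBD.prod_right hBC 0).prod_zero_left (hAC.prod_zero_right_of_regular hAD hRD)
    (hBD.prod_right hBR 0)

theorem IsLocal.prod_prod_zero_prod_zero (hBD : IsLocal K B D) (hAC : SimplePoleOPE A C R)
    (hAD : SimplePoleOPE A D 0) (hBC : SimplePoleOPE B C 0) (hBR : SimplePoleOPE B R 0)
    (hRD : SimplePoleOPE R D 0) (p : ℤ) :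
    prod p (prod 0 A B) (prod 0 C D) = prod 0 R (prod (p - 1) B D) +
      ∑ q ∈ Finset.Icc p K, prod (p - q) A (prod 0 C (prod q B D)) := by
  rw [(hAC.prod_zero_right_of_regular hAD hRD).prod_prod_zero_left (hBD.prod_right hBC 0),
    prod_left_comm _ _ hBR]
  simp only [prod_left_comm _ _ hBC]

theorem SimplePoleOPE.pole_left (hAB : SimplePoleOPE A B D) (hAC : SimplePoleOPE A C 0)
    (hBC : SimplePoleOPE B C 0) : SimplePoleOPE D C 0 := by
  simpa using hAB.jacobi hBC hAC (simplePoleOPE_zero_right A)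
    (simplePoleOPE_zero_right B)

end Locality

section Nested

variable {V : Type*} [AddCommGroup V] [Module ℂ V] {N : ℕ}
  {A : VertexOperator ℂ V} {P Q R : Fin N → VertexOperator ℂ V}

theorem nested_succ (P : Fin N → VertexOperator ℂ V) {n : ℕ} (hn : n + 1 ≤ N) :
    nested P (n + 1) hn = prod 0 (P ⟨n, hn⟩) (nested P n (Nat.le_of_succ_le hn)) := by
  cases n with
  | zero => exact (prod_idField _).symm
  | succ n => rfl

theorem simplePoleOPE_nested_right {n : ℕ} {hn : n ≤ N}
    (h : ∀ i : Fin N, i < n → SimplePoleOPE A (P i) 0) : SimplePoleOPE A (nested P n hn) 0 := by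
  induction n with
  | zero => exact simplePoleOPE_idField_right A
  | succ n ih =>
    rw [nested_succ]
    exact (h ⟨n, hn⟩ n.lt_succ_self).prod_right (ih fun i hi => h i (hi.trans n.lt_succ_self)) 0

theorem simplePoleOPE_nested_of_pairwise (h : Pairwise fun i j => SimplePoleOPE (Q i) (P j) 0)
    {n : ℕ} (hn : n + 1 ≤ N) :
    SimplePoleOPE (Q ⟨n, hn⟩) (nested P n (Nat.le_of_succ_le hn)) 0 :=
  simplePoleOPE_nested_right fun _ hi => h (Fin.ne_of_gt hi)

/-- Two families of fields with regular OPEs between fields of different indices and with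
`P i (z) Q i (w) ∼ R i (w) / (z - w)`. -/
structure IsSimplePolePairing {ι : Type*} (P Q R : ι → VertexOperator ℂ V) : Prop where
  left_left : Pairwise fun i j => SimplePoleOPE (P i) (P j) 0
  right_right : Pairwise fun i j => SimplePoleOPE (Q i) (Q j) 0
  left_right : Pairwise fun i j => SimplePoleOPE (P i) (Q j) 0
  pole : ∀ i, SimplePoleOPE (P i) (Q i) (R i)

namespace IsSimplePolePairing

theorem right_left (h : IsSimplePolePairing P Q R) :
    Pairwise fun i j => SimplePoleOPE (Q i) (P j) 0 :=
  fun _ _ hij => (h.left_right hij.symm).symm_zero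

theorem pole_left (h : IsSimplePolePairing P Q R) :
    Pairwise fun i j => SimplePoleOPE (R i) (P j) 0 :=
  fun i _ hij => (h.pole i).pole_left (h.left_left hij) (h.right_left hij)

theorem pole_right (h : IsSimplePolePairing P Q R) :
    Pairwise fun i j => SimplePoleOPE (R i) (Q j) 0 :=
  fun i _ hij => (h.pole i).pole_left (h.left_right hij) (h.right_right hij)

theorem isLocal_nested (h : IsSimplePolePairing P Q R) (n : ℕ) (hn : n ≤ N) :
    IsLocal n (nested P n hn) (nested Q n hn) := by
  induction n with
  | zero => exact (simplePoleOPE_idField_right _).isLocal_zero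
  | succ n ih =>
    rw [nested_succ, nested_succ]
    exact (ih _).prod_zero_prod_zero (h.pole _) (simplePoleOPE_nested_of_pairwise h.left_right hn)
      (simplePoleOPE_nested_of_pairwise h.right_left hn).symm_zero
      (simplePoleOPE_nested_of_pairwise h.pole_left hn).symm_zero
      (simplePoleOPE_nested_of_pairwise h.pole_right hn)

theorem prod_nested_succ (h : IsSimplePolePairing P Q R) {n : ℕ} (hn : n + 1 ≤ N) (p : ℤ) :
    prod p (nested P (n + 1) hn) (nested Q (n + 1) hn) =
      prod 0 (R ⟨n, hn⟩)
          (prod (p - 1) (nested P n (Nat.le_of_succ_le hn)) (nested Q n (Nat.le_of_succ_le hn))) +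
        ∑ q ∈ Finset.Icc p (n : ℤ), prod (p - q) (P ⟨n, hn⟩) (prod 0 (Q ⟨n, hn⟩)
          (prod q (nested P n (Nat.le_of_succ_le hn)) (nested Q n (Nat.le_of_succ_le hn)))) := by
  rw [nested_succ, nested_succ]
  exact (h.isLocal_nested n _).prod_prod_zero_prod_zero (h.pole _)
    (simplePoleOPE_nested_of_pairwise h.left_right hn)
    (simplePoleOPE_nested_of_pairwise h.right_left hn).symm_zero
    (simplePoleOPE_nested_of_pairwise h.pole_left hn).symm_zero
    (simplePoleOPE_nested_of_pairwise h.pole_right hn) p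

end IsSimplePolePairing

end Nested

namespace SymplecticBosons

variable {ι : Type*} [DecidableEq ι] {V : Type*} [AddCommGroup V] [Module ℂ V]
  (S : SymplecticBosons ι V) {A : VertexOperator ℂ V} (i : ι)

theorem ope_X_Y : SimplePoleOPE (S.X i) (S.Y i) idField := by
  simpa using S.ope_XY i i

theorem ope_X_gauge : SimplePoleOPE (S.X i) (S.gauge i) (-S.X i) := by
  have h := (S.ope_XX i i).prod_zero_right (S.ope_X_Y i) (simplePoleOPE_zero_left _)
  simpa [gauge, zero_prod, prod_idField] using h.neg_right

theorem ope_X_prod_Y_X : SimplePoleOPE (S.X i) (prod 0 (S.Y i) (S.X i)) (S.X i) := by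
  simpa [prod_zero, idField_prod] using (S.ope_X_Y i).prod_zero_right (S.ope_XX i i)
    (simplePoleOPE_idField_right _).symm_zero

theorem ope_Y_X : SimplePoleOPE (S.Y i) (S.X i) (-idField) :=
  (S.ope_X_Y i).symm

theorem ope_Y_gauge : SimplePoleOPE (S.Y i) (S.gauge i) (S.Y i) := by
  have h := (S.ope_Y_X i).prod_zero_right (S.ope_YY i i) (simplePoleOPE_neg_idField_left _)
  simpa [gauge, prod_zero, prod_neg_left, idField_prod] using h.neg_right

theorem ope_Y_prod_Y_X : SimplePoleOPE (S.Y i) (prod 0 (S.Y i) (S.X i)) (-S.Y i) := by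
  simpa [zero_prod, prod_neg_right, prod_idField] using
    (S.ope_YY i i).prod_zero_right (S.ope_Y_X i) (simplePoleOPE_zero_left _)

theorem ope_gauge_X : SimplePoleOPE (S.gauge i) (S.X i) (S.X i) := by
  simpa using (S.ope_X_gauge i).symm

theorem covD_X : S.covD i (S.X i) =
    prod 0 (S.gauge i) (S.X i) + prod 0 (S.gauge i) (S.X i) +
      prod 0 (S.X i) (prod 0 (S.Y i) (S.X i)) := by
  rw [covD, covDWith, partialD, gaugeHat, one_smul]
  abel

theorem ope_X_covD : SimplePoleOPE (S.X i) (S.covD i (S.X i)) (-prod 0 (S.X i) (S.X i)) := by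
  have hgX : SimplePoleOPE (S.X i) (prod 0 (S.gauge i) (S.X i)) (-prod 0 (S.X i) (S.X i)) := by
    simpa [prod_zero, prod_neg_left] using (S.ope_X_gauge i).prod_zero_right (S.ope_XX i i)
      (by simpa using (S.ope_XX i i).neg_right.symm)
  have hXN : SimplePoleOPE (S.X i) (prod 0 (S.X i) (prod 0 (S.Y i) (S.X i)))
      (prod 0 (S.X i) (S.X i)) := by
    simpa [zero_prod] using (S.ope_XX i i).prod_zero_right (S.ope_X_prod_Y_X i)
      (simplePoleOPE_zero_left _)
  rw [covD_X]
  simpa using (hgX.add_right hgX).add_right hXN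

theorem ope_covD_X : SimplePoleOPE (S.covD i (S.X i)) (S.X i) (prod 0 (S.X i) (S.X i)) := by
  simpa using (S.ope_X_covD i).symm

theorem ope_Y_covD : DoublePoleOPE (S.Y i) (S.covD i (S.X i))
    (prod 0 (S.Y i) (S.X i) - S.gauge i) ((-2 : ℂ) • idField) := by
  have hgX : DoublePoleOPE (S.Y i) (prod 0 (S.gauge i) (S.X i))
      (prod 0 (S.Y i) (S.X i) - S.gauge i) (-idField) := by
    simpa [zero_prod, prod_zero, prod_neg_right, prod_idField, sub_eq_add_neg] using
      (S.ope_Y_gauge i).doublePoleOPE.prod_zero_right (S.ope_Y_X i).doublePoleOPE (S.ope_Y_X i)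
        (simplePoleOPE_zero_left _)
  have hXN : SimplePoleOPE (S.Y i) (prod 0 (S.X i) (prod 0 (S.Y i) (S.X i)))
      (S.gauge i - prod 0 (S.Y i) (S.X i)) := by
    convert (S.ope_Y_X i).prod_zero_right (S.ope_Y_prod_Y_X i)
      (simplePoleOPE_neg_idField_left _) using 1
    rw [prod_neg_left, prod_neg_right, idField_prod, gauge]
    abel
  rw [covD_X]
  convert (hgX.add_right hgX).add_right hXN.doublePoleOPE using 1
  · abel
  · module

theorem ope_covD_Y : DoublePoleOPE (S.covD i (S.X i)) (S.Y i)
    (S.gauge i - prod 0 (S.Y i) (S.X i)) ((-2 : ℂ) • idField) := by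
  simpa using (S.ope_Y_covD i).symm

theorem ope_prod_Y_X_X : SimplePoleOPE (prod 0 (S.Y i) (S.X i)) (S.X i) (-S.X i) :=
  (S.ope_X_prod_Y_X i).symm

theorem ope_prod_X_X_Y :
    SimplePoleOPE (prod 0 (S.X i) (S.X i)) (S.Y i) (S.X i + S.X i) := by
  have h := (S.ope_Y_X i).prod_zero_right (S.ope_Y_X i) (simplePoleOPE_neg_idField_left _)
  rw [prod_neg_left, prod_neg_right, idField_prod, prod_idField] at h
  simpa [add_comm] using h.symm

theorem ope_gauge_prod_X_X : SimplePoleOPE (S.gauge i) (prod 0 (S.X i) (S.X i))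
    (prod 0 (S.X i) (S.X i) + prod 0 (S.X i) (S.X i)) :=
  (S.ope_gauge_X i).prod_zero_right (S.ope_gauge_X i) (S.ope_XX i i)

theorem ope_prod_X_X_prod_Y_X : SimplePoleOPE (prod 0 (S.X i) (S.X i)) (prod 0 (S.Y i) (S.X i))
    (prod 0 (S.X i) (S.X i) + prod 0 (S.X i) (S.X i)) := by
  have h := (S.ope_prod_Y_X_X i).prod_zero_right (S.ope_prod_Y_X_X i)
    (by simpa using (S.ope_XX i i).neg_right.symm)
  rw [prod_neg_left, prod_neg_right] at h
  simpa [add_comm] using h.symm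

theorem ope_covD_gauge :
    ∃ U, SimplePoleOPE (S.covD i (S.X i)) (S.gauge i) U := by
  refine ⟨_, ((S.ope_covD_X i).doublePoleOPE.prod_zero_right (S.ope_covD_Y i)
    (S.ope_prod_X_X_Y i) (simplePoleOPE_zero_left _)).neg_right.simplePoleOPE ?_⟩
  rw [zero_prod, prod_smul_right, prod_idField]
  module

theorem ope_covD_prod_Y_X :
    ∃ U, SimplePoleOPE (S.covD i (S.X i)) (prod 0 (S.Y i) (S.X i)) U := by
  have hpole : SimplePoleOPE (S.gauge i - prod 0 (S.Y i) (S.X i)) (S.X i) (S.X i + S.X i) := by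
    rw [sub_eq_add_neg]
    simpa [add_comm] using ((S.ope_X_gauge i).add_right (S.ope_X_prod_Y_X i).neg_right).symm
  refine ⟨_, ((S.ope_covD_Y i).prod_zero_right (S.ope_covD_X i).doublePoleOPE hpole
    (simplePoleOPE_smul_idField_left _ _)).simplePoleOPE ?_⟩
  rw [prod_zero, prod_smul_left, idField_prod]
  module

theorem ope_covD_covD : SimplePoleOPE (S.covD i (S.X i)) (S.covD i (S.X i)) 0 := by
  obtain ⟨U, hU⟩ := S.ope_covD_gauge i
  obtain ⟨U', hU'⟩ := S.ope_covD_prod_Y_X i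
  have hUX : SimplePoleOPE U (S.X i) (-prod 0 (S.X i) (S.X i)) := by
    simpa using hU.jacobi (S.ope_gauge_X i) (S.ope_covD_X i) (S.ope_covD_X i)
      (S.ope_gauge_prod_X_X i)
  have hgX := hU.doublePoleOPE.prod_zero_right (S.ope_covD_X i).doublePoleOPE hUX
    (simplePoleOPE_zero_left _)
  have hXN := (S.ope_covD_X i).doublePoleOPE.prod_zero_right hU'.doublePoleOPE
    (S.ope_prod_X_X_prod_Y_X i) (simplePoleOPE_zero_left _)
  obtain ⟨D, hD⟩ : ∃ D, SimplePoleOPE (S.covD i (S.X i)) (S.covD i (S.X i)) D := by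
    have h := (hgX.add_right hgX).add_right hXN
    rw [← covD_X] at h
    refine ⟨_, h.simplePoleOPE ?_⟩
    simp only [zero_prod, prod_zero]
    abel
  exact hD.eq_zero_of_self ▸ hD

theorem ope_factor (a b : Kind) :
    SimplePoleOPE (S.factor i a) (S.factor i b) (S.R i a b) := by
  cases a <;> cases b
  exacts [S.ope_XX i i, S.ope_X_covD i, S.ope_covD_X i, S.ope_covD_covD i]

theorem R_self (a : Kind) : S.R i a a = 0 := by
  cases a <;> rfl

variable {S i}

theorem simplePoleOPE_factor_right (hX : SimplePoleOPE A (S.X i) 0)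
    (hY : SimplePoleOPE A (S.Y i) 0) (b : Kind) : SimplePoleOPE A (S.factor i b) 0 := by
  have hg : SimplePoleOPE A (S.gauge i) 0 := by simpa [gauge] using (hX.prod_right hY 0).neg_right
  have hgX := hg.prod_right hX 0
  cases b with
  | plain => exact hX
  | cov =>
    rw [factor, covD_X]
    simpa using (hgX.add_right hgX).add_right (hX.prod_right (hY.prod_right hX 0) 0)

theorem ope_factor_of_ne {j : ι} (hij : i ≠ j) (a b : Kind) :
    SimplePoleOPE (S.factor i a) (S.factor j b) 0 := by
  have hXX := S.ope_XX i j
  have hXY : SimplePoleOPE (S.X i) (S.Y j) 0 := by simpa [hij] using S.ope_XY i j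
  have hYX : SimplePoleOPE (S.Y i) (S.X j) 0 := by simpa [hij.symm] using (S.ope_XY j i).symm
  exact simplePoleOPE_factor_right
    (simplePoleOPE_factor_right hXX.symm_zero hYX.symm_zero a).symm_zero
    (simplePoleOPE_factor_right hXY.symm_zero (S.ope_YY i j).symm_zero a).symm_zero b

theorem isSimplePolePairing_factor (S : SymplecticBosons ι V) (a b : ι → Kind) :
    IsSimplePolePairing (fun i => S.factor i (a i)) (fun i => S.factor i (b i))
      fun i => S.R i (a i) (b i) where
  left_left _ _ h := ope_factor_of_ne h _ _
  right_right _ _ h := ope_factor_of_ne h _ _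
  left_right _ _ h := ope_factor_of_ne h _ _
  pole _ := S.ope_factor _ _ _

end SymplecticBosons

end SymplecticBoson

end

open SymplecticBoson in
theorem theorem1 {V : Type*} [AddCommGroup V] [Module ℂ V] {N : ℕ}
    (S : SymplecticBosons (Fin N) V) (a b : Fin N → Kind)
    (n : ℕ) (hn : 1 ≤ n) (hN : n + 1 ≤ N) (p : ℤ)
    (P Q : Fin N → VertexOperator ℂ V)
    (hP : ∀ i, P i = S.factor i (a i)) (hQ : ∀ i, Q i = S.factor i (b i)) :
    (p ≤ n →
      prod p (nested P (n + 1) hN) (nested Q (n + 1) hN) =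
        prod 0 (S.R ⟨n, hN⟩ (a ⟨n, hN⟩) (b ⟨n, hN⟩))
            (prod (p - 1) (nested P n (Nat.le_of_succ_le hN)) (nested Q n (Nat.le_of_succ_le hN))) +
          ∑ q ∈ Finset.Icc p (n : ℤ),
            prod (p - q) (P ⟨n, hN⟩)
              (prod 0 (Q ⟨n, hN⟩)
                (prod q (nested P n (Nat.le_of_succ_le hN))
                  (nested Q n (Nat.le_of_succ_le hN))))) ∧
    (p = n + 1 →
      prod p (nested P (n + 1) hN) (nested Q (n + 1) hN) =
        prod 0 (S.R ⟨n, hN⟩ (a ⟨n, hN⟩) (b ⟨n, hN⟩))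
          (prod (p - 1) (nested P n (Nat.le_of_succ_le hN))
            (nested Q n (Nat.le_of_succ_le hN)))) ∧
    ((n : ℤ) + 2 ≤ p →
      prod p (nested P (n + 1) hN) (nested Q (n + 1) hN) = 0) ∧
    (a ⟨n, hN⟩ = b ⟨n, hN⟩ →
      (p ≤ n →
        prod p (nested P (n + 1) hN) (nested Q (n + 1) hN) =
          ∑ q ∈ Finset.Icc p (n : ℤ),
            prod (p - q) (P ⟨n, hN⟩)
              (prod 0 (Q ⟨n, hN⟩)
                (prod q (nested P n (Nat.le_of_succ_le hN))
                  (nested Q n (Nat.le_of_succ_le hN))))) ∧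
      ((n : ℤ) + 1 ≤ p →
        prod p (nested P (n + 1) hN) (nested Q (n + 1) hN) = 0)) := by
  have hPQ : IsSimplePolePairing P Q fun i => S.R i (a i) (b i) := by
    rw [funext hP, funext hQ]
    exact S.isSimplePolePairing_factor a b
  have hsucc := hPQ.prod_nested_succ hN p
  have hempty (hp : (n : ℤ) + 1 ≤ p) : Finset.Icc p (n : ℤ) = ∅ :=
    Finset.Icc_eq_empty_of_lt (Int.lt_of_add_one_le hp)
  have hR (hab : a ⟨n, hN⟩ = b ⟨n, hN⟩) : S.R ⟨n, hN⟩ (a ⟨n, hN⟩) (b ⟨n, hN⟩) = 0 := by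
    rw [hab, SymplecticBosons.R_self]
  refine ⟨fun _ => hsucc, fun hp => ?_, fun hp => ?_, fun hab => ⟨fun _ => ?_, fun hp => ?_⟩⟩
  · rw [hsucc, hempty hp.ge, Finset.sum_empty, add_zero]
  · rw [hsucc, hempty (by omega), Finset.sum_empty, add_zero,
      (hPQ.isLocal_nested n _).prod_eq_zero (by omega), prod_zero]
  · rw [hsucc, hR hab, zero_prod, zero_add]
  · rw [hsucc, hempty hp, hR hab, zero_prod, Finset.sum_empty, add_zero]
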